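/- Let $G$ be a group and let $M$ be an abelian $G$-module, written additively. A *crossed module* consists of a group $E_0$, a group $E_1$ on which $E_0$ acts from the left by group automorphisms $m\mapsto {}^{e}m$, and a homomorphism $\mu\colon E_1\to E_0$ with $\mu({}^{e}m)=e\,\mu(m)\,e^{-1}$ and ${}^{\mu(n)}m=nmn^{-1}$ for all $e\in E_0$ and $m,n\in E_1$. A *crossed module extension* of $G$ with $M$ is a crossed module $E=(\mu\colon E_1\to E_0)$ together with an injective homomorphism $\iota\colon M\to E_1$ and a surjective homomorphism $\pi\colon E_0\to G$ such that $\operatorname{im}\iota=\ker\mu$, $\operatorname{im}\mu=\ker\pi$, and ${}^{e}\iota(m)=\iota(\pi(e)m)$ for all $e\in E_0$, $m\in M$. All groups are taken in one fixed universe (containing $G$, $M$ and an infinite set). An *extension equivalence* $E\to\tilde E$ is a pair of homomorphisms $\varphi_0\colon E_0\to\tilde E_0$, $\varphi_1\colon E_1\to\tilde E_1$ (not necessarily invertible) with $\tilde\mu\varphi_1=\varphi_0\mu$, $\varphi_1({}^{e}m)={}^{\varphi_0(e)}\varphi_1(m)$, $\varphi_1\iota=\tilde\iota$ and $\tilde\pi\varphi_0=\pi$.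 The relation $\approx$ ("$E$ and $\tilde E$ are equivalent") is the equivalence relation on crossed module extensions of $G$ with $M$ generated by the relation "there is an extension equivalence $E\to\tilde E$". Let $Z^3_{\mathrm{cpt}}(G,M)$ be the group of 3-cocycles $z\colon G^3\to M$ of $G$ with coefficients in $M$, that is, of maps with $$z(l,k,h)-z(l,k,hg)+z(l,kh,g)-z(lk,h,g)+l\,z(k,h,g)=0 \quad (l,k,h,g\in G),$$ that are *componentwise pointed*: they vanish whenever one argument is $1$. Let $B^3_{\mathrm{cpt}}(G,M)$ be the subgroup of componentwise pointed maps of the form $(k,h,g)\mapsto c(k,h)-c(k,hg)+c(kh,g)-k\,c(h,g)$ with $c\colon G^2\to M$, and let $H^3_{\mathrm{cpt}}(G,M)=Z^3_{\mathrm{cpt}}(G,M)/B^3_{\mathrm{cpt}}(G,M)$. A *lifting system* for $E$ is a pair of maps $Z^1\colon G\to E_0$, $Z^2\colon G\times G\to E_1$ with $\pi(Z^1(g))=g$, $Z^1(1)=1$, $\mu(Z^2(h,g))=Z^1(h)Z^1(g)Z^1(hg)^{-1}$ and $Z^2(1,g)=Z^2(g,1)=1$. It yields a cocycle in $Z^3_{\mathrm{cpt}}(G,M)$,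 $$(k,h,g)\mapsto \iota^{-1}\big(Z^2(k,h)\,Z^2(kh,g)\,Z^2(k,hg)^{-1}\,({}^{Z^1(k)}Z^2(h,g))^{-1}\big).$$ The class $\mathrm{cl}(E)\in H^3_{\mathrm{cpt}}(G,M)$ associated to $E$ is the class of this cocycle for an arbitrarily chosen lifting system. For $z\in Z^3_{\mathrm{cpt}}(G,M)$ the *standard extension* $\mathrm{E}(z)$ is $$M\to M\times\ker\pi\to F\to G,$$ where $F$ is the free group on the pointed set $(G,1)$ with basis $s\colon G\to F$ (so $s(1)=1$ and $F$ is free on the $s(g)$, $g\neq1$), $\pi\colon F\to G$ is the homomorphism with $\pi(s(g))=g$, the maps $M\to M\times\ker\pi\to F$ are $m\mapsto(m,1)$ and $(m,r)\mapsto r$, and $F$ acts on $M\times\ker\pi$ through $${}^{s(k)}(m,1)=(km,1),\qquad {}^{s(k)}(0,z_2(h,g))=\big(-z(k,h,g),\;s(k)\,z_2(h,g)\,s(k)^{-1}\big),$$ with $z_2(h,g)=s(h)s(g)s(hg)^{-1}$; these elements generate $\ker\pi$. **Statement.** Let $E$ and $\tilde E$ be crossed module extensions of $G$ with $M$, and let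 $z\in Z^3_{\mathrm{cpt}}(G,M)$ satisfy $\mathrm{cl}(E)=z+B^3_{\mathrm{cpt}}(G,M)$. Then $E\approx\tilde E$ if and only if there exist extension equivalences $\mathrm{E}(z)\to E$ and $\mathrm{E}(z)\to\tilde E$. In particular, if $E\approx\tilde E$, then there are a crossed module extension $S$ of $G$ with $M$ and extension equivalences $S\to E$ and $S\to\tilde E$. -/

import Mathlib

universe u

/-! ### Crossed modules -/

/-- A crossed module: a group (the group part), a group on which it acts by automorphisms (the
module part), and an equivariant homomorphism from the module part to the group part that
satisfies the Peiffer identity. -/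
structure CrossedModule : Type (u + 1) where
  groupPart : Type u
  modulePart : Type u
  [groupPartGroup : Group groupPart]
  [modulePartGroup : Group modulePart]
  [action : MulDistribMulAction groupPart modulePart]
  /-- The structure morphism. -/
  bd : modulePart →* groupPart
  equivariance : ∀ (g : groupPart) (m : modulePart), bd (g • m) = g * bd m * g⁻¹
  peiffer : ∀ n m : modulePart, bd n • m = n * m * n⁻¹

attribute [instance] CrossedModule.groupPartGroup CrossedModule.modulePartGroup
  CrossedModule.action

/-- A morphism of crossed modules. -/
structure CrossedModule.Hom (V W : CrossedModule.{u}) where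
  groupHom : V.groupPart →* W.groupPart
  moduleHom : V.modulePart →* W.modulePart
  comm : ∀ m : V.modulePart, W.bd (moduleHom m) = groupHom (V.bd m)
  map_smul : ∀ (g : V.groupPart) (m : V.modulePart), moduleHom (g • m) = groupHom g • moduleHom m

/-! ### Crossed module extensions and their equivalence -/

/-- A crossed module extension of the group `G` with the abelian `G`-module `M`: an exact sequence
`M → modulePart → groupPart → G` with `ι` injective and `π` surjective, whose induced action of
`G` on `M` is the given one. -/
structure CrossedModuleExtension (G M : Type u) [Group G] [AddCommGroup M]
    [DistribMulAction G M] : Type (u + 1) extends CrossedModule.{u} where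
  /-- The canonical monomorphism. -/
  ι : Multiplicative M →* modulePart
  /-- The canonical epimorphism. -/
  π : groupPart →* G
  ι_injective : Function.Injective ι
  π_surjective : Function.Surjective π
  range_ι : ι.range = bd.ker
  range_bd : bd.range = π.ker
  smul_ι : ∀ (e : groupPart) (m : M),
    e • ι (Multiplicative.ofAdd m) = ι (Multiplicative.ofAdd (π e • m))

namespace CrossedModuleExtension

variable {G M : Type u} [Group G] [AddCommGroup M] [DistribMulAction G M]

/-- An extension equivalence from `E` to `E'`: a morphism of crossed modules that is compatible
with the canonical monomorphisms and epimorphisms (it need not be invertible). -/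
structure Equivalence (E E' : CrossedModuleExtension G M)
    extends CrossedModule.Hom E.toCrossedModule E'.toCrossedModule where
  moduleHom_ι : ∀ m : Multiplicative M, moduleHom (E.ι m) = E'.ι m
  π_groupHom : ∀ e : E.groupPart, E'.π (groupHom e) = E.π e

/-- Two extensions are equivalent if they are related by the equivalence relation generated by
the existence of an extension equivalence from one to the other. -/
def Equivalent (E E' : CrossedModuleExtension G M) : Prop :=
  Relation.EqvGen (fun X Y : CrossedModuleExtension G M => Nonempty (Equivalence X Y)) E E'

end CrossedModuleExtension

/-! ### Componentwise pointed third cohomology -/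

namespace CptCohomology

variable (G M : Type u) [Group G] [AddCommGroup M] [DistribMulAction G M]

/-- The differential from 2-cochains to 3-cochains. -/
def d₂ : (G → G → M) →+ (G → G → G → M) where
  toFun c := fun k h g => c k h - c k (h * g) + c (k * h) g - k • c h g
  map_zero' := by funext k h g; simp
  map_add' a b := by funext k h g; simp only [Pi.add_apply, smul_add]; abel

/-- The differential from 3-cochains to 4-cochains. -/
def d₃ : (G → G → G → M) →+ (G → G → G → G → M) where
  toFun c := fun l k h g =>
    c l k h - c l k (h * g) + c l (k * h) g - c (l * k) h g + l • c k h g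
  map_zero' := by funext l k h g; simp
  map_add' a b := by funext l k h g; simp only [Pi.add_apply, smul_add]; abel

/-- The componentwise pointed 3-cochains: those that vanish as soon as one argument is `1`. -/
def C₃ : AddSubgroup (G → G → G → M) where
  carrier := {c | ∀ h g, c 1 h g = 0 ∧ c h 1 g = 0 ∧ c h g 1 = 0}
  zero_mem' := by intro h g; simp
  add_mem' {a b} ha hb := by
    intro h g
    obtain ⟨h1, h2, h3⟩ := ha h g
    obtain ⟨h4, h5, h6⟩ := hb h g
    simp [h1, h2, h3, h4, h5, h6]
  neg_mem' {a} ha := by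
    intro h g
    obtain ⟨h1, h2, h3⟩ := ha h g
    simp [h1, h2, h3]

/-- The componentwise pointed 3-cocycles. -/
def Z₃ : AddSubgroup (G → G → G → M) := C₃ G M ⊓ (d₃ G M).ker

/-- The componentwise pointed 3-coboundaries. -/
def B₃ : AddSubgroup (G → G → G → M) := C₃ G M ⊓ (d₂ G M).range

/-- The third componentwise pointed cohomology group. -/
abbrev H₃ : Type u := Z₃ G M ⧸ (B₃ G M).addSubgroupOf (Z₃ G M)

end CptCohomology

/-! ### The cohomology class of a crossed module extension -/

namespace CrossedModuleExtension

open CptCohomology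

variable {G M : Type u} [Group G] [AddCommGroup M] [DistribMulAction G M]

/-- A lifting system: a pointed section `Z₁` of `π` and a componentwise pointed lift `Z₂` along the
structure morphism of the non-abelian 2-cocycle `(h, g) ↦ Z₁ h * Z₁ g * (Z₁ (h * g))⁻¹`. -/
structure LiftingSystem (E : CrossedModuleExtension G M) where
  Z₁ : G → E.groupPart
  Z₂ : G → G → E.modulePart
  π_Z₁ : ∀ g, E.π (Z₁ g) = g
  Z₁_one : Z₁ 1 = 1
  bd_Z₂ : ∀ h g, E.bd (Z₂ h g) = Z₁ h * Z₁ g * (Z₁ (h * g))⁻¹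
  Z₂_one_left : ∀ g, Z₂ 1 g = 1
  Z₂_one_right : ∀ g, Z₂ g 1 = 1

instance LiftingSystem.instNonempty (E : CrossedModuleExtension G M) :
    Nonempty E.LiftingSystem := by
  classical
  choose s hs using E.π_surjective
  let Z : G → E.groupPart := fun g => if g = 1 then 1 else s g
  have hZ1 : Z 1 = 1 := if_pos rfl
  have hZ : ∀ g, E.π (Z g) = g := by
    intro g
    by_cases h : g = 1
    · subst h; rw [hZ1, map_one]
    · simp only [Z, if_neg h, hs]
  have hex : ∀ h g, ∃ m, E.bd m = Z h * Z g * (Z (h * g))⁻¹ := by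
    intro h g
    have : Z h * Z g * (Z (h * g))⁻¹ ∈ E.bd.range := by
      rw [E.range_bd, MonoidHom.mem_ker]; simp [hZ]
    exact this
  choose t ht using hex
  refine ⟨⟨Z, fun h g => if h = 1 ∨ g = 1 then 1 else t h g, hZ, hZ1, ?_, ?_, ?_⟩⟩
  · intro h g
    by_cases hh : h = 1
    · subst hh; simp [hZ1]
    · by_cases hg : g = 1
      · subst hg; simp [hZ1]
      · simp [hh, hg, ht]
  · intro g; simp
  · intro g; simp

theorem ι_comm (E : CrossedModuleExtension G M) (m : Multiplicative M) (x : E.modulePart) :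
    x * E.ι m = E.ι m * x := by
  have h0 : E.bd (E.ι m) = 1 := by
    have : E.ι m ∈ E.bd.ker := E.range_ι ▸ ⟨m, rfl⟩
    exact this
  have h := E.peiffer (E.ι m) x
  rw [h0, one_smul] at h
  conv_lhs => rw [h]
  group

namespace LiftingSystem

variable {E : CrossedModuleExtension G M} (Z : E.LiftingSystem)

theorem exists_cocycle (k h g : G) : ∃ m : Multiplicative M,
    E.ι m = Z.Z₂ k h * Z.Z₂ (k * h) g * (Z.Z₂ k (h * g))⁻¹ * (Z.Z₁ k • Z.Z₂ h g)⁻¹ := by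
  change _ ∈ E.ι.range
  rw [E.range_ι, MonoidHom.mem_ker]
  simp only [map_mul, map_inv, E.equivariance, Z.bd_Z₂]
  rw [mul_assoc k h g]
  group

/-- The 3-cocycle of `E` with respect to a lifting system: the unique preimage under `ι` of
`Z₂(k,h) Z₂(kh,g) Z₂(k,hg)⁻¹ (ᵏZ₂(h,g))⁻¹`, where `k` acts through `Z₁ k`. -/
noncomputable def cocycle (k h g : G) : M :=
  (Z.exists_cocycle k h g).choose.toAdd

theorem ι_cocycle (k h g : G) : E.ι (Multiplicative.ofAdd (Z.cocycle k h g)) =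
    Z.Z₂ k h * Z.Z₂ (k * h) g * (Z.Z₂ k (h * g))⁻¹ * (Z.Z₁ k • Z.Z₂ h g)⁻¹ :=
  (Z.exists_cocycle k h g).choose_spec

theorem Z₂_mul (k h g : G) : Z.Z₂ k h * Z.Z₂ (k * h) g =
    E.ι (Multiplicative.ofAdd (Z.cocycle k h g)) * (Z.Z₁ k • Z.Z₂ h g * Z.Z₂ k (h * g)) := by
  rw [ι_cocycle]; group

theorem cocycle_mem : Z.cocycle ∈ Z₃ G M := by
  have inj : ∀ a b : M, E.ι (Multiplicative.ofAdd a) = E.ι (Multiplicative.ofAdd b) → a = b :=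
    fun a b hab => E.ι_injective hab
  refine AddSubgroup.mem_inf.mpr ⟨?_, ?_⟩
  · intro h g
    refine ⟨inj _ _ ?_, inj _ _ ?_, inj _ _ ?_⟩ <;>
      simp [ι_cocycle, Z.Z₂_one_left, Z.Z₂_one_right, Z.Z₁_one]
  · rw [AddMonoidHom.mem_ker]
    funext l k h g
    have key : E.ι (Multiplicative.ofAdd (Z.cocycle (l * k) h g + Z.cocycle l k (h * g))) =
        E.ι (Multiplicative.ofAdd
          (Z.cocycle l k h + Z.cocycle l (k * h) g + l • Z.cocycle k h g)) := by
      have hconj : ∀ y, Z.Z₂ l k * (Z.Z₁ (l * k) • y) =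
          (Z.Z₁ l • Z.Z₁ k • y) * Z.Z₂ l k := by
        intro y
        have h1 := E.peiffer (Z.Z₂ l k) (Z.Z₁ (l * k) • y)
        rw [Z.bd_Z₂, smul_smul, inv_mul_cancel_right, mul_smul] at h1
        rw [h1]; group
      have e1 : Z.Z₂ l k * Z.Z₂ (l * k) h * Z.Z₂ (l * k * h) g =
          E.ι (Multiplicative.ofAdd (Z.cocycle (l * k) h g + Z.cocycle l k (h * g))) *
          ((Z.Z₁ l • Z.Z₁ k • Z.Z₂ h g) * (Z.Z₁ l • Z.Z₂ k (h * g)) * Z.Z₂ l (k * (h * g))) := by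
        rw [mul_assoc, Z.Z₂_mul (l * k) h g, ← mul_assoc, E.ι_comm, ofAdd_add, map_mul]
        simp only [mul_assoc]
        rw [← mul_assoc (Z.Z₂ l k), hconj, mul_assoc, Z.Z₂_mul l k (h * g),
          ← mul_assoc (Z.Z₁ l • Z.Z₁ k • Z.Z₂ h g), E.ι_comm]
        simp only [mul_assoc]
      have e2 : Z.Z₂ l k * Z.Z₂ (l * k) h * Z.Z₂ (l * k * h) g =
          E.ι (Multiplicative.ofAdd
            (Z.cocycle l k h + Z.cocycle l (k * h) g + l • Z.cocycle k h g)) *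
          ((Z.Z₁ l • Z.Z₁ k • Z.Z₂ h g) * (Z.Z₁ l • Z.Z₂ k (h * g)) * Z.Z₂ l (k * (h * g))) := by
        have h3 : (Z.Z₁ l • Z.Z₂ k h) * (Z.Z₁ l • Z.Z₂ (k * h) g) =
            E.ι (Multiplicative.ofAdd (l • Z.cocycle k h g)) *
            ((Z.Z₁ l • Z.Z₁ k • Z.Z₂ h g) * (Z.Z₁ l • Z.Z₂ k (h * g))) := by
          rw [← smul_mul', Z.Z₂_mul k h g, smul_mul', smul_mul', E.smul_ι, Z.π_Z₁]
        rw [Z.Z₂_mul l k h, mul_assoc, mul_assoc, mul_assoc l k h, Z.Z₂_mul l (k * h) g,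
          ← mul_assoc (Z.Z₁ l • Z.Z₂ k h), E.ι_comm, mul_assoc (E.ι _),
          ← mul_assoc (Z.Z₁ l • Z.Z₂ k h), h3, ofAdd_add, ofAdd_add, map_mul, map_mul]
        simp only [mul_assoc]
      exact mul_right_cancel (e1.symm.trans e2)
    have := inj _ _ key
    change Z.cocycle l k h - Z.cocycle l k (h * g) + Z.cocycle l (k * h) g -
      Z.cocycle (l * k) h g + l • Z.cocycle k h g = 0
    rw [← sub_eq_zero] at this
    rw [← neg_eq_zero, ← this]
    abel

end LiftingSystem

/-- The cohomology class associated to `E`: the class of the 3-cocycle of `E` with respect to an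
arbitrarily chosen lifting system. -/
noncomputable def cohomologyClass (E : CrossedModuleExtension G M) : H₃ G M :=
  QuotientAddGroup.mk ⟨(Classical.arbitrary E.LiftingSystem).cocycle,
    (Classical.arbitrary E.LiftingSystem).cocycle_mem⟩

end CrossedModuleExtension

/-! ### The standard extension of a componentwise pointed 3-cocycle -/

namespace StandardExtension

open CptCohomology

section FreePart

variable (G : Type u) [Group G]

/-- The free group on the underlying pointed set of `G`, that is, on the set `G \ {1}`. -/
abbrev F : Type u := FreeGroup {g : G // g ≠ 1}

variable {G}

open Classical in
/-- The basis of `F G`, a pointed map. -/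
noncomputable def basis (g : G) : F G :=
  if h : g = 1 then 1 else FreeGroup.of ⟨g, h⟩

@[simp] theorem basis_one : basis (1 : G) = 1 := dif_pos rfl

theorem basis_of (x : {g : G // g ≠ 1}) : basis x.1 = FreeGroup.of x := dif_neg x.2

variable (G) in
/-- The extension of the identity of `G` to `F G`. -/
def proj : F G →* G := FreeGroup.lift Subtype.val

@[simp] theorem proj_basis (g : G) : proj G (basis g) = g := by
  by_cases h : g = 1
  · subst h; simp
  · simp [proj, basis, h]

variable (G) in
/-- The kernel of the projection from the free group to `G`. -/
abbrev K : Subgroup (F G) := (proj G).ker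

/-- The non-abelian 2-cocycle of `F G` with respect to the basis. -/
noncomputable def z₂ (h g : G) : K G :=
  ⟨basis h * basis g * (basis (h * g))⁻¹, by simp [MonoidHom.mem_ker]⟩

theorem coe_z₂ (h g : G) : (z₂ h g : F G) = basis h * basis g * (basis (h * g))⁻¹ := rfl

theorem mem_closure_z₂ (w : F G) :
    w * (basis (proj G w))⁻¹ ∈
      Subgroup.closure (Set.range fun p : G × G => (z₂ p.1 p.2 : F G)) := by
  set N := Subgroup.closure (Set.range fun p : G × G => (z₂ p.1 p.2 : F G)) with hN
  have hz : ∀ h g : G, (z₂ h g : F G) ∈ N := fun h g => Subgroup.subset_closure ⟨(h, g), rfl⟩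
  have main : ∀ w : F G, ∀ x : G, basis x * w * (basis (x * proj G w))⁻¹ ∈ N := by
    intro w
    induction w using FreeGroup.induction_on with
    | C1 => intro x; simp
    | of y =>
      intro x
      change basis x * FreeGroup.of y * (basis (x * proj G (FreeGroup.of y)))⁻¹ ∈ N
      rw [← basis_of, proj_basis]
      exact hz x y.1
    | inv_of y _ =>
      intro x
      change basis x * (FreeGroup.of y)⁻¹ * (basis (x * proj G (FreeGroup.of y)⁻¹))⁻¹ ∈ N
      have h1 := N.inv_mem (hz (x * y.1⁻¹) y.1)
      rw [coe_z₂, inv_mul_cancel_right] at h1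
      rw [← basis_of, map_inv, proj_basis]
      convert h1 using 1
      group
    | mul a b ha hb =>
      intro x
      have h1 := N.mul_mem (ha x) (hb (x * proj G a))
      rw [map_mul]
      convert h1 using 1
      simp only [mul_assoc, inv_mul_cancel_left]
  simpa using main w 1

/-- Homomorphisms on `K G` are determined by their values on the non-abelian 2-cocycle. -/
theorem hom_ext_K {H : Type*} [Group H] {f f' : K G →* H}
    (hf : ∀ h g, f (z₂ h g) = f' (z₂ h g)) : f = f' := by
  have hle : Subgroup.closure (Set.range fun p : G × G => (z₂ p.1 p.2 : F G)) ≤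
      (f.eqLocus f').map (K G).subtype := by
    rw [Subgroup.closure_le]
    rintro _ ⟨p, rfl⟩
    exact ⟨z₂ p.1 p.2, hf _ _, rfl⟩
  ext ⟨r, hr⟩
  have h1 := mem_closure_z₂ r
  rw [MonoidHom.mem_ker.mp hr, basis_one, inv_one, mul_one] at h1
  obtain ⟨y, hy, hyr⟩ := hle h1
  have : y = ⟨r, hr⟩ := Subtype.ext hyr
  exact this ▸ hy

theorem conj_z₂ (k h g : G) : MulAut.conjNormal (basis k) (z₂ h g) =
    z₂ k h * z₂ (k * h) g * (z₂ k (h * g))⁻¹ := by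
  apply Subtype.ext
  simp only [MulAut.conjNormal_apply, Subgroup.coe_mul, Subgroup.coe_inv, coe_z₂, mul_assoc k h g]
  group

end FreePart

section Extend

variable {G M : Type u} [Group G] [AddCommGroup M]

variable (G M) in
/-- The action of `G` on maps `G → M` by right translation of the argument. -/
def shift : G →* MulAut (G → Multiplicative M) where
  toFun g :=
    { toFun := fun φ x => φ (x * g)
      invFun := fun φ x => φ (x * g⁻¹)
      left_inv := fun φ => by funext x; simp
      right_inv := fun φ => by funext x; simp
      map_mul' := fun φ ψ => rfl }
  map_one' := by ext φ x; simp
  map_mul' g h := by ext φ x; simp [mul_assoc]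

/-- Auxiliary homomorphism used to extend maps from the 2-cocycle `z₂` to `K G`. -/
def wordHom (f : G → G → M) : F G →* (G → Multiplicative M) ⋊[shift G M] G :=
  FreeGroup.lift fun g => ⟨fun x => Multiplicative.ofAdd (f x g), g⟩

theorem wordHom_right (f : G → G → M) (w : F G) : (wordHom f w).right = proj G w := by
  have : (SemidirectProduct.rightHom).comp (wordHom f) = proj G := by
    ext x; simp [wordHom, proj]
  exact DFunLike.congr_fun this w

theorem wordHom_basis (f : G → G → M) (hf : ∀ h, f h 1 = 0) (g : G) :
    wordHom f (basis g) = ⟨fun x => Multiplicative.ofAdd (f x g), g⟩ := by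
  by_cases h : g = 1
  · subst h
    rw [basis_one, map_one]
    ext x
    · simp [hf]
    · simp
  · simp [wordHom, basis, h]

/-- The homomorphism `K G → M` with `z₂ h g ↦ f h g`, for a componentwise pointed map `f`. -/
def extendHom (f : G → G → M) : K G →* Multiplicative M where
  toFun r := (wordHom f r).left 1
  map_one' := by simp
  map_mul' a b := by
    have ha : (wordHom f a).right = 1 := by rw [wordHom_right]; exact a.2
    simp [SemidirectProduct.mul_left, ha]

theorem extendHom_z₂ (f : G → G → M) (hf : ∀ h, f h 1 = 0) (hf' : ∀ h, f 1 h = 0) (h g : G) :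
    extendHom f (z₂ h g) = Multiplicative.ofAdd (f h g) := by
  change (wordHom f (basis h * basis g * (basis (h * g))⁻¹)).left 1 = _
  rw [map_mul, map_mul, map_inv, wordHom_basis f hf, wordHom_basis f hf, wordHom_basis f hf]
  change Multiplicative.ofAdd (f 1 h) * Multiplicative.ofAdd (f (1 * h) g) *
    (Multiplicative.ofAdd (f (1 * (h * g) * (h * g)⁻¹) (h * g)))⁻¹ = _
  simp [hf']

/-- The module part of the standard extension. -/
abbrev Mod (G M : Type u) [Group G] : Type u := Multiplicative M × K G

/-- Homomorphisms on `M × K G` are determined by their values on `M` and on the `z₂ h g`. -/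
theorem hom_ext_Mod {H : Type*} [Group H] {f f' : Mod G M →* H}
    (h1 : ∀ m : M, f (Multiplicative.ofAdd m, 1) = f' (Multiplicative.ofAdd m, 1))
    (h2 : ∀ h g, f (1, z₂ h g) = f' (1, z₂ h g)) : f = f' := by
  have h3 : f.comp (MonoidHom.inr _ _) = f'.comp (MonoidHom.inr _ _) := hom_ext_K h2
  have h4 : f.comp (MonoidHom.inl _ _) = f'.comp (MonoidHom.inl _ _) :=
    MonoidHom.ext fun m => h1 m.toAdd
  refine MonoidHom.ext fun x => ?_
  have hx : x = (x.1, 1) * (1, x.2) := by simp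
  rw [hx, map_mul, map_mul]
  exact congrArg₂ (· * ·) (DFunLike.congr_fun h4 x.1) (DFunLike.congr_fun h3 x.2)

end Extend

variable {G M : Type u} [Group G] [AddCommGroup M] [DistribMulAction G M]

variable (M) in
/-- The action of `k : G` on `M`, written multiplicatively. -/
def actM (k : G) : MulAut (Multiplicative M) :=
  AddEquiv.toMultiplicative (DistribMulAction.toAddEquiv M k)

@[simp] theorem actM_apply (k : G) (m : M) :
    actM M k (Multiplicative.ofAdd m) = Multiplicative.ofAdd (k • m) := rfl

/-- The automorphism of `M × K G` by which the free generator `basis k` acts: it sends `(m, 1)`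
to `(k m, 1)` and `(0, z₂ h g)` to `(-z k h g, ᵏ(z₂ h g))`, with `k` acting on `K G` by conjugation
with `basis k`. -/
noncomputable def genAut (z : Z₃ G M) (k : G) : MulAut (Mod G M) where
  toFun x := (actM M k x.1 * extendHom (fun h g => -z.1 k h g) x.2,
    MulAut.conjNormal (basis k) x.2)
  invFun x := ((actM M k).symm (x.1 * (extendHom (fun h g => -z.1 k h g)
      ((MulAut.conjNormal (basis k)).symm x.2))⁻¹),
    (MulAut.conjNormal (basis k)).symm x.2)
  left_inv x := by ext <;> simp
  right_inv x := by ext <;> simp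
  map_mul' x y := by
    ext1
    · simp only [Prod.fst_mul, Prod.snd_mul, map_mul]
      exact mul_mul_mul_comm _ _ _ _
    · simp

theorem genAut_apply (z : Z₃ G M) (k : G) (x : Mod G M) :
    genAut z k x = (actM M k x.1 * extendHom (fun h g => -z.1 k h g) x.2,
      MulAut.conjNormal (basis k) x.2) := rfl

theorem genAut_inl (z : Z₃ G M) (k : G) (m : M) :
    genAut z k (Multiplicative.ofAdd m, 1) = (Multiplicative.ofAdd (k • m), 1) := by
  simp [genAut_apply]

theorem genAut_z₂ (z : Z₃ G M) (k h g : G) :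
    genAut z k (1, z₂ h g) =
      (Multiplicative.ofAdd (-z.1 k h g), MulAut.conjNormal (basis k) (z₂ h g)) := by
  rw [genAut_apply, extendHom_z₂]
  · simp
  · intro h; simp [(z.2.1 k h).2.2]
  · intro h; simp [(z.2.1 k h).2.1]

theorem genAut_one (z : Z₃ G M) : genAut z 1 = 1 := by
  have : (genAut z 1).toMonoidHom = MonoidHom.id _ := by
    apply hom_ext_Mod
    · intro m; simp [genAut_inl]
    · intro h g; simp [genAut_z₂, (z.2.1 h g).1]
  ext1 x
  exact DFunLike.congr_fun this x

/-- The action of the free group `F G` on `M × K G`. -/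
noncomputable def actHom (z : Z₃ G M) : F G →* MulAut (Mod G M) :=
  FreeGroup.lift fun k => genAut z k

theorem actHom_basis (z : Z₃ G M) (k : G) : actHom z (basis k) = genAut z k := by
  by_cases h : k = 1
  · subst h; rw [basis_one, map_one, genAut_one]
  · simp [actHom, basis, h]

theorem actHom_snd (z : Z₃ G M) (w : F G) (x : Mod G M) :
    (actHom z w x).2 = MulAut.conjNormal w x.2 := by
  induction w using FreeGroup.induction_on generalizing x with
  | C1 => simp
  | of y =>
    change (actHom z (FreeGroup.of y) x).2 = MulAut.conjNormal (FreeGroup.of y) x.2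
    rw [← basis_of, actHom_basis]; rfl
  | inv_of y _ =>
    change (actHom z (FreeGroup.of y)⁻¹ x).2 = MulAut.conjNormal (FreeGroup.of y)⁻¹ x.2
    rw [← basis_of, map_inv, actHom_basis, map_inv]; rfl
  | mul a b ha hb => rw [map_mul, map_mul, MulAut.mul_apply, ha, hb, MulAut.mul_apply]

theorem actHom_inl (z : Z₃ G M) (w : F G) (m : M) :
    actHom z w (Multiplicative.ofAdd m, 1) = (Multiplicative.ofAdd (proj G w • m), 1) := by
  induction w using FreeGroup.induction_on generalizing m with
  | C1 => simp
  | of y =>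
    rw [← basis_of, actHom_basis, genAut_inl, proj_basis]
  | inv_of y _ =>
    change actHom z (FreeGroup.of y)⁻¹ _ =
      (Multiplicative.ofAdd (proj G (FreeGroup.of y)⁻¹ • m), 1)
    rw [← basis_of, map_inv, actHom_basis, map_inv, proj_basis, MulAut.inv_apply,
      MulEquiv.symm_apply_eq, genAut_inl, smul_inv_smul]
  | mul a b ha hb => rw [map_mul, map_mul, MulAut.mul_apply, hb, ha, mul_smul]

theorem actHom_K (z : Z₃ G M) (r : K G) :
    actHom z (r : F G) = MulAut.conj ((1, r) : Mod G M) := by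
  have : (actHom z).comp (K G).subtype =
      (MulAut.conj (G := Mod G M)).comp (MonoidHom.inr (Multiplicative M) (K G)) := by
    apply hom_ext_K
    intro l k
    change actHom z (basis l * basis k * (basis (l * k))⁻¹) =
      MulAut.conj ((1, z₂ l k) : Mod G M)
    rw [map_mul, map_mul, map_inv, mul_inv_eq_iff_eq_mul, actHom_basis, actHom_basis,
      actHom_basis]
    have key : ((genAut z l * genAut z k : MulAut (Mod G M)) : Mod G M ≃* Mod G M).toMonoidHom =
        ((MulAut.conj ((1, z₂ l k) : Mod G M) * genAut z (l * k) : MulAut (Mod G M)) :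
          Mod G M ≃* Mod G M).toMonoidHom := by
      apply hom_ext_Mod
      · intro m
        change genAut z l (genAut z k _) = MulAut.conj _ (genAut z (l * k) _)
        rw [genAut_inl, genAut_inl, genAut_inl, mul_smul]
        simp [MulAut.conj_apply]
      · intro h g
        change genAut z l (genAut z k _) = MulAut.conj _ (genAut z (l * k) _)
        have hz0 : z.1 l k h - z.1 l k (h * g) + z.1 l (k * h) g - z.1 (l * k) h g +
            l • z.1 k h g = 0 := by
          have := AddMonoidHom.mem_ker.mp (AddSubgroup.mem_inf.mp z.2).2
          exact congrFun (congrFun (congrFun (congrFun this l) k) h) g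
        have e1 : ∀ h, -z.1 l h 1 = 0 := fun h => by simp [(z.2.1 l h).2.2]
        have e2 : ∀ h, -z.1 l 1 h = 0 := fun h => by simp [(z.2.1 l h).2.1]
        rw [genAut_z₂, genAut_z₂, genAut_apply]
        refine Prod.ext ?_ (Subtype.ext ?_)
        · simp only [conj_z₂, map_mul, map_inv, actM_apply, MulAut.conj_apply, Prod.fst_mul,
            Prod.fst_inv]
          rw [extendHom_z₂ _ e1 e2, extendHom_z₂ _ e1 e2, extendHom_z₂ _ e1 e2]
          rw [inv_one, one_mul, mul_one]
          apply Multiplicative.toAdd.injective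
          simp only [toAdd_mul, toAdd_ofAdd, toAdd_inv, smul_neg]
          rw [← sub_eq_zero, ← neg_eq_zero, ← hz0]
          abel
        · simp only [MulAut.conj_apply, Prod.snd_mul, Prod.snd_inv, Subgroup.coe_mul,
            Subgroup.coe_inv, MulAut.conjNormal_apply, coe_z₂ l k]
          group
    ext1 x
    exact DFunLike.congr_fun key x
  exact DFunLike.congr_fun this r

end StandardExtension

open StandardExtension in
/-- The standard extension of `G` with `M` with respect to the componentwise pointed 3-cocycle `z`:
the sequence `M → M × ker π → F → G` with `F` the free group on the pointed set `G`. -/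
noncomputable def standardExtension {G M : Type u} [Group G] [AddCommGroup M]
    [DistribMulAction G M] (z : CptCohomology.Z₃ G M) : CrossedModuleExtension G M where
  groupPart := F G
  modulePart := Mod G M
  action := MulDistribMulAction.compHom (Mod G M) (actHom z)
  bd := (K G).subtype.comp (MonoidHom.snd (Multiplicative M) (K G))
  equivariance w x := by
    change ((actHom z w x).2 : F G) = w * (x.2 : F G) * w⁻¹
    rw [actHom_snd, MulAut.conjNormal_apply]
  peiffer n m := by
    change actHom z (n.2 : F G) m = n * m * n⁻¹
    rw [actHom_K, MulAut.conj_apply]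
    ext1
    · simp
    · simp
  ι := MonoidHom.inl (Multiplicative M) (K G)
  π := proj G
  ι_injective := fun a b h => congrArg Prod.fst h
  π_surjective := fun g => ⟨basis g, proj_basis g⟩
  range_ι := by
    ext x
    rw [MonoidHom.mem_ker]
    constructor
    · rintro ⟨m, rfl⟩; rfl
    · intro h
      exact ⟨x.1, Prod.ext rfl (Subtype.ext h).symm⟩
  range_bd := by
    ext w
    constructor
    · rintro ⟨x, rfl⟩; exact x.2.2
    · intro h; exact ⟨(1, ⟨w, h⟩), rfl⟩
  smul_ι w m := actHom_inl z w m

/-! An extension equivalence from the standard extension of `z` to `E` amounts to a lifting system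
of `E` whose cocycle is exactly `z`, not merely cohomologous to `z`
(`nonempty_equivalence_standardExtension_iff`). One direction pushes forward the lifting system
given by the basis of the free group. For the other, `Z₁` extends to the free group, and `Z₂`
extends to the kernel `K G` because every componentwise pointed map on pairs, even with non-abelian
values, extends to `K G` along `z₂` (`groupExtendHom_z₂`). Compatibility with the actions is then
the cocycle identity on generators (`modHom_genAut`).

The cocycles of the lifting systems of `E` fill a whole class modulo coboundaries: any two are
cohomologous (`cocycle_sub_cocycle_mem`), and every representative occurs after modifying `Z₂` by a
pointed cochain (`exists_cocycle_eq`). So the standard extension of `z` maps to `E` precisely when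
`z` represents the class of `E`. Extension equivalences preserve cocycles of lifting systems, so
this property is constant on equivalence classes, and the standard extension serves as a common
source. -/

namespace StandardExtension

theorem z₂_one_left {G : Type u} [Group G] (g : G) : z₂ 1 g = 1 :=
  Subtype.ext (by simp [coe_z₂])

theorem z₂_one_right {G : Type u} [Group G] (g : G) : z₂ g 1 = 1 :=
  Subtype.ext (by simp [coe_z₂])

/-! ### Extending group-valued maps from `z₂` to the kernel `K G` -/

section Extend

variable {G H : Type u} [Group G] [Group H]

variable (G H) in
/-- The action of `G` on maps from `G` to a group by right translation of the argument. -/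
def groupShift : G →* MulAut (G → H) where
  toFun g :=
    { toFun := fun φ x => φ (x * g)
      invFun := fun φ x => φ (x * g⁻¹)
      left_inv := fun φ => by funext x; simp
      right_inv := fun φ => by funext x; simp
      map_mul' := fun φ ψ => rfl }
  map_one' := by ext φ x; simp
  map_mul' g h := by ext φ x; simp [mul_assoc]

/-- Auxiliary homomorphism used to extend group-valued maps from the 2-cocycle `z₂` to `K G`. -/
def groupWordHom (f : G → G → H) : F G →* (G → H) ⋊[groupShift G H] G :=
  FreeGroup.lift fun g => ⟨fun x => f x g, g⟩

theorem groupWordHom_right (f : G → G → H) (w : F G) :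
    (groupWordHom f w).right = proj G w := by
  have : (SemidirectProduct.rightHom).comp (groupWordHom f) = proj G := by
    ext x; simp [groupWordHom, proj]
  exact DFunLike.congr_fun this w

theorem groupWordHom_basis (f : G → G → H) (hf : ∀ h, f h 1 = 1) (g : G) :
    groupWordHom f (basis g) = ⟨fun x => f x g, g⟩ := by
  by_cases h : g = 1
  · subst h
    rw [basis_one, map_one]
    exact SemidirectProduct.ext (funext fun x => (hf x).symm) rfl
  · simp [groupWordHom, basis, h]

/-- The homomorphism on `K G` that extends a componentwise pointed group-valued map. -/
def groupExtendHom (f : G → G → H) : K G →* H where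
  toFun r := (groupWordHom f r).left 1
  map_one' := by simp
  map_mul' r s := by
    -- Words in the kernel have trivial `G`-component, so no shift occurs and evaluation at `1` is
    -- multiplicative.
    have hr : (groupWordHom f (r : F G)).right = 1 := by
      rw [groupWordHom_right]; exact r.2
    rw [Subgroup.coe_mul, map_mul, SemidirectProduct.mul_left, hr, map_one]
    rfl

/-- The semidirect product reads a word from left to right: each letter `g` met after a prefix with
image `x` in `G` contributes `f x g`. Along `z₂ h g` the contributions are `f 1 h`, `f h g` and the
inverse of `f 1 (h * g)`, and pointedness removes the outer two. -/
theorem groupExtendHom_z₂ (f : G → G → H) (hf : ∀ h, f h 1 = 1) (hf' : ∀ h, f 1 h = 1)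
    (h g : G) : groupExtendHom f (z₂ h g) = f h g := by
  change (groupWordHom f (basis h * basis g * (basis (h * g))⁻¹)).left 1 = _
  rw [map_mul, map_mul, map_inv, groupWordHom_basis f hf, groupWordHom_basis f hf,
    groupWordHom_basis f hf]
  change f 1 h * f (1 * h) g * (f (1 * (h * g) * (h * g)⁻¹) (h * g))⁻¹ = _
  simp [hf']

end Extend

end StandardExtension

/-! ### Pointed primitives of coboundaries -/

namespace CptCohomology

variable {G M : Type u} [Group G] [AddCommGroup M] [DistribMulAction G M]

/-- A componentwise pointed 3-coboundary is the differential of a componentwise pointed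
2-cochain. -/
theorem exists_pointed_of_mem_B₃ {b : G → G → G → M} (hb : b ∈ B₃ G M) :
    ∃ c : G → G → M, (∀ g, c 1 g = 0) ∧ (∀ g, c g 1 = 0) ∧ d₂ G M c = b := by
  obtain ⟨hp, c, rfl⟩ := hb
  have h1 : ∀ g, c 1 g = c 1 1 := fun g => by
    have : c 1 1 - c 1 (1 * g) + c (1 * 1) g - (1 : G) • c 1 g = 0 := (hp 1 g).1
    simp only [one_mul, one_smul] at this
    rw [add_sub_cancel_right, sub_eq_zero] at this
    exact this.symm
  have h2 : ∀ k, c k 1 = k • c 1 1 := fun k => by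
    have : c k 1 - c k (1 * 1) + c (k * 1) 1 - k • c 1 1 = 0 := (hp k 1).2.2
    simp only [mul_one, sub_self, zero_add] at this
    exact sub_eq_zero.mp this
  -- The correction `k • c 1 1` is the coboundary of the constant 1-cochain with value `c 1 1`, so
  -- the differential does not change.
  refine ⟨fun k h => c k h - k • c 1 1, fun g => by simp [h1 g], fun g => by simp [h2 g], ?_⟩
  funext k h g
  change (c k h - k • c 1 1) - (c k (h * g) - k • c 1 1) + (c (k * h) g - (k * h) • c 1 1) -
    k • (c h g - h • c 1 1) = c k h - c k (h * g) + c (k * h) g - k • c h g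
  rw [smul_sub, mul_smul]
  abel

end CptCohomology

/-! ### Lifting systems and the variation of their cocycles -/

namespace CrossedModuleExtension

open CptCohomology StandardExtension

variable {G M : Type u} [Group G] [AddCommGroup M] [DistribMulAction G M]

/-- The composite of two extension equivalences. -/
def Equivalence.comp {X Y W : CrossedModuleExtension G M} (f : Equivalence Y W)
    (e : Equivalence X Y) : Equivalence X W where
  groupHom := f.groupHom.comp e.groupHom
  moduleHom := f.moduleHom.comp e.moduleHom
  comm m := by simp [f.comm, e.comm]
  map_smul g m := by simp [f.map_smul, e.map_smul]
  moduleHom_ι m := by simp [f.moduleHom_ι, e.moduleHom_ι]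
  π_groupHom g := by simp [f.π_groupHom, e.π_groupHom]

theorem bd_ι (E : CrossedModuleExtension G M) (m : Multiplicative M) : E.bd (E.ι m) = 1 := by
  have : E.ι m ∈ E.bd.ker := E.range_ι ▸ ⟨m, rfl⟩
  exact this

namespace LiftingSystem

variable {E : CrossedModuleExtension G M}

/-- Injectivity of `ι` reduces the computation of a cocycle value to a single product identity free
of inverses. -/
theorem cocycle_eq_of_mul (Z : E.LiftingSystem) {k h g : G} {m : M}
    (hm : Z.Z₂ k h * Z.Z₂ (k * h) g =
      E.ι (Multiplicative.ofAdd m) * (Z.Z₁ k • Z.Z₂ h g * Z.Z₂ k (h * g))) :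
    Z.cocycle k h g = m := by
  rw [Z.Z₂_mul] at hm
  exact E.ι_injective (mul_right_cancel hm)

/-- By the Peiffer identity, the failure of `Z₁` to be multiplicative acts as conjugation by `Z₂`.
-/
theorem Z₂_mul_smul (Z : E.LiftingSystem) (l k : G) (y : E.modulePart) :
    Z.Z₂ l k * (Z.Z₁ (l * k) • y) = (Z.Z₁ l • Z.Z₁ k • y) * Z.Z₂ l k := by
  have h1 := E.peiffer (Z.Z₂ l k) (Z.Z₁ (l * k) • y)
  rw [Z.bd_Z₂, smul_smul, inv_mul_cancel_right, mul_smul] at h1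
  rw [h1]; group

/-- The image of a lifting system under an extension equivalence. -/
def map {E' : CrossedModuleExtension G M} (Z : E.LiftingSystem) (f : Equivalence E E') :
    E'.LiftingSystem where
  Z₁ g := f.groupHom (Z.Z₁ g)
  Z₂ h g := f.moduleHom (Z.Z₂ h g)
  π_Z₁ g := by rw [f.π_groupHom, Z.π_Z₁]
  Z₁_one := by rw [Z.Z₁_one, map_one]
  bd_Z₂ h g := by rw [f.comm, Z.bd_Z₂, map_mul, map_mul, map_inv]
  Z₂_one_left g := by rw [Z.Z₂_one_left, map_one]
  Z₂_one_right g := by rw [Z.Z₂_one_right, map_one]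

theorem cocycle_map {E' : CrossedModuleExtension G M} (Z : E.LiftingSystem)
    (f : Equivalence E E') : (Z.map f).cocycle = Z.cocycle := by
  funext k h g
  apply cocycle_eq_of_mul
  simp only [map]
  rw [← map_mul, Z.Z₂_mul, map_mul, map_mul, f.moduleHom_ι, f.map_smul]

/-- The lifting system that arises by multiplying `Z₂` with a componentwise pointed 2-cochain. -/
def twist (Z : E.LiftingSystem) (c : G → G → M) (h1 : ∀ g, c 1 g = 0) (h2 : ∀ g, c g 1 = 0) :
    E.LiftingSystem where
  Z₁ := Z.Z₁
  Z₂ h g := E.ι (Multiplicative.ofAdd (c h g)) * Z.Z₂ h g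
  π_Z₁ := Z.π_Z₁
  Z₁_one := Z.Z₁_one
  bd_Z₂ h g := by rw [map_mul, E.bd_ι, one_mul, Z.bd_Z₂]
  Z₂_one_left g := by simp [h1, Z.Z₂_one_left]
  Z₂_one_right g := by simp [h2, Z.Z₂_one_right]

/-- The values of `ι` are central and `Z₁ k` acts on them through `k`, so the factors from `c`
collect into its differential. -/
theorem cocycle_twist (Z : E.LiftingSystem) (c : G → G → M) (h1 : ∀ g, c 1 g = 0)
    (h2 : ∀ g, c g 1 = 0) : (Z.twist c h1 h2).cocycle = Z.cocycle + d₂ G M c := by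
  funext k h g
  apply cocycle_eq_of_mul
  have hι : ∀ (a b : M) (x y : E.modulePart),
      E.ι (Multiplicative.ofAdd a) * x * (E.ι (Multiplicative.ofAdd b) * y) =
        E.ι (Multiplicative.ofAdd (a + b)) * (x * y) := fun a b x y => by
    rw [mul_assoc, ← mul_assoc x, E.ι_comm, ofAdd_add, map_mul]
    simp only [mul_assoc]
  simp only [twist, smul_mul', E.smul_ι, Z.π_Z₁, hι]
  rw [Z.Z₂_mul, ← mul_assoc (E.ι _) (E.ι _), ← mul_assoc (E.ι _) (E.ι _), ← map_mul E.ι, ← map_mul E.ι,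
    ← ofAdd_add, ← ofAdd_add]
  congr 3
  change c k h + c (k * h) g + Z.cocycle k h g = Z.cocycle k h g +
    (c k h - c k (h * g) + c (k * h) g - k • c h g) + (k • c h g + c k (h * g))
  abel

/-- The lifting system that arises by changing the section `Z₁` along a pointed map to the module
part. -/
def changeSection (Z : E.LiftingSystem) (a : G → E.modulePart) (ha : a 1 = 1) :
    E.LiftingSystem where
  Z₁ g := E.bd (a g) * Z.Z₁ g
  Z₂ h g := a h * (Z.Z₁ h • a g) * Z.Z₂ h g * (a (h * g))⁻¹
  π_Z₁ g := by
    have : E.bd (a g) ∈ E.π.ker := E.range_bd ▸ ⟨a g, rfl⟩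
    rw [map_mul, MonoidHom.mem_ker.mp this, one_mul, Z.π_Z₁]
  Z₁_one := by rw [ha, Z.Z₁_one, map_one, one_mul]
  bd_Z₂ h g := by
    simp only [map_mul, map_inv, E.equivariance, Z.bd_Z₂]
    group
  Z₂_one_left g := by simp [ha, Z.Z₁_one, Z.Z₂_one_left]
  Z₂_one_right g := by simp [ha, Z.Z₂_one_right]

/-- The new `Z₂` is built so that the factors from `a` cancel, once the Peiffer identity turns the
action of `E.bd (a k)` into conjugation by `a k`. The cocycle therefore stays the same on the nose,
not just up to a coboundary. -/
theorem cocycle_changeSection (Z : E.LiftingSystem) (a : G → E.modulePart) (ha : a 1 = 1) :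
    (Z.changeSection a ha).cocycle = Z.cocycle := by
  funext k h g
  apply cocycle_eq_of_mul
  change (a k * (Z.Z₁ k • a h) * Z.Z₂ k h * (a (k * h))⁻¹) *
      (a (k * h) * (Z.Z₁ (k * h) • a g) * Z.Z₂ (k * h) g * (a (k * h * g))⁻¹) =
    E.ι _ * ((E.bd (a k) * Z.Z₁ k) • (a h * (Z.Z₁ h • a g) * Z.Z₂ h g * (a (h * g))⁻¹) *
      (a k * (Z.Z₁ k • a (h * g)) * Z.Z₂ k (h * g) * (a (k * (h * g)))⁻¹))
  calc _ = a k * (Z.Z₁ k • a h) * (Z.Z₂ k h * (Z.Z₁ (k * h) • a g)) * Z.Z₂ (k * h) g *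
        (a (k * h * g))⁻¹ := by group
    _ = a k * (Z.Z₁ k • a h) * (Z.Z₁ k • Z.Z₁ h • a g) * (Z.Z₂ k h * Z.Z₂ (k * h) g) *
        (a (k * h * g))⁻¹ := by rw [Z.Z₂_mul_smul]; group
    _ = E.ι (Multiplicative.ofAdd (Z.cocycle k h g)) * (a k * (Z.Z₁ k • a h) *
        (Z.Z₁ k • Z.Z₁ h • a g) * (Z.Z₁ k • Z.Z₂ h g * Z.Z₂ k (h * g))) *
        (a (k * h * g))⁻¹ := by
      rw [Z.Z₂_mul, ← mul_assoc _ (E.ι _), E.ι_comm, mul_assoc (E.ι _)]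
    _ = _ := by
      rw [mul_smul, E.peiffer, mul_assoc k h g]
      simp only [smul_mul', smul_inv']
      group

/-- The cocycles of two lifting systems of an extension are cohomologous. -/
theorem cocycle_sub_cocycle_mem (Z W : E.LiftingSystem) : W.cocycle - Z.cocycle ∈ B₃ G M := by
  classical
  refine AddSubgroup.mem_inf.mpr ⟨(C₃ G M).sub_mem (AddSubgroup.mem_inf.mp W.cocycle_mem).1
    (AddSubgroup.mem_inf.mp Z.cocycle_mem).1, ?_⟩
  have hex : ∀ g, ∃ x, E.bd x = W.Z₁ g * (Z.Z₁ g)⁻¹ := fun g => by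
    change _ ∈ E.bd.range
    rw [E.range_bd, MonoidHom.mem_ker, map_mul, map_inv, W.π_Z₁, Z.π_Z₁, mul_inv_cancel]
  choose b hb using hex
  -- The chosen `b 1` need only lie in the kernel of `E.bd`; it is replaced by `1` to keep the new
  -- lifting system pointed.
  let a : G → E.modulePart := fun g => if g = 1 then 1 else b g
  have ha1 : a 1 = 1 := if_pos rfl
  have ha : ∀ g, E.bd (a g) * Z.Z₁ g = W.Z₁ g := fun g => by
    by_cases h : g = 1
    · subst h; rw [ha1, map_one, one_mul, Z.Z₁_one, W.Z₁_one]
    · simp [a, h, hb]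
  let V := Z.changeSection a ha1
  have hV : ∀ g, V.Z₁ g = W.Z₁ g := ha
  -- Now that the sections agree, both second components lift the same elements and differ by values
  -- of `ι`, so `W` is a twist of `V`.
  have hex : ∀ h g, ∃ m : Multiplicative M, E.ι m = W.Z₂ h g * (V.Z₂ h g)⁻¹ := fun h g => by
    change _ ∈ E.ι.range
    rw [E.range_ι, MonoidHom.mem_ker, map_mul, map_inv, W.bd_Z₂, V.bd_Z₂, hV, hV, hV,
      mul_inv_cancel]
  choose c hc using hex
  have hc1 : ∀ g, (c 1 g).toAdd = 0 := fun g => by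
    apply E.ι_injective (a₁ := c 1 g) (a₂ := 1)
    rw [hc, W.Z₂_one_left, V.Z₂_one_left, map_one, inv_one, mul_one]
  have hc2 : ∀ g, (c g 1).toAdd = 0 := fun g => by
    apply E.ι_injective (a₁ := c g 1) (a₂ := 1)
    rw [hc, W.Z₂_one_right, V.Z₂_one_right, map_one, inv_one, mul_one]
  have key : W = V.twist (fun h g => (c h g).toAdd) hc1 hc2 := by
    have e1 : W.Z₁ = (V.twist (fun h g => (c h g).toAdd) hc1 hc2).Z₁ :=
      funext fun g => (hV g).symm
    have e2 : W.Z₂ = (V.twist (fun h g => (c h g).toAdd) hc1 hc2).Z₂ := by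
      funext h g
      change _ = E.ι (c h g) * V.Z₂ h g
      rw [hc, inv_mul_cancel_right]
    generalize V.twist (fun h g => (c h g).toAdd) hc1 hc2 = U at e1 e2
    cases W; cases U
    cases e1; cases e2
    rfl
  rw [key, cocycle_twist, cocycle_changeSection, add_sub_cancel_left]
  exact ⟨_, rfl⟩

/-- Every cocycle cohomologous to the cocycle of a lifting system comes from a lifting system. -/
theorem exists_cocycle_eq (Z : E.LiftingSystem) {z : G → G → G → M}
    (hz : z - Z.cocycle ∈ B₃ G M) : ∃ W : E.LiftingSystem, W.cocycle = z := by
  obtain ⟨c, h1, h2, hc⟩ := exists_pointed_of_mem_B₃ hz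
  exact ⟨Z.twist c h1 h2, by rw [cocycle_twist, hc, add_sub_cancel]⟩

/-! ### Lifting systems as extension equivalences out of the standard extension -/

/-- The lifting system of the standard extension given by the basis of the free group. -/
noncomputable def standard (z : Z₃ G M) : (standardExtension z).LiftingSystem where
  Z₁ := basis
  Z₂ h g := ((1, z₂ h g) : Mod G M)
  π_Z₁ := proj_basis
  Z₁_one := basis_one
  bd_Z₂ _ _ := rfl
  Z₂_one_left g := congrArg (Prod.mk 1) (z₂_one_left g)
  Z₂_one_right g := congrArg (Prod.mk 1) (z₂_one_right g)

/-- The minus sign in the action on `(1, z₂ h g)` is what makes the basis recover `z` itself. -/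
theorem cocycle_standard (z : Z₃ G M) : (standard z).cocycle = z.1 := by
  funext k h g
  apply cocycle_eq_of_mul
  change ((1, z₂ k h) : Mod G M) * ((1, z₂ (k * h) g) : Mod G M) =
    ((Multiplicative.ofAdd (z.1 k h g), 1) : Mod G M) *
      (actHom z (basis k) (1, z₂ h g) * ((1, z₂ k (h * g)) : Mod G M))
  rw [actHom_basis, genAut_z₂, conj_z₂, Prod.mk_mul_mk, Prod.mk_mul_mk, Prod.mk_mul_mk]
  simp

/-- The group part of the equivalence induced by a lifting system. -/
noncomputable def freeHom (Z : E.LiftingSystem) : F G →* E.groupPart :=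
  FreeGroup.lift fun g => Z.Z₁ g

theorem freeHom_basis (Z : E.LiftingSystem) (g : G) : Z.freeHom (basis g) = Z.Z₁ g := by
  by_cases h : g = 1
  · subst h; rw [basis_one, map_one, Z.Z₁_one]
  · simp [freeHom, basis, h]

/-- The module part of the equivalence induced by a lifting system. -/
noncomputable def modHom (Z : E.LiftingSystem) : Mod G M →* E.modulePart :=
  MonoidHom.noncommCoprod E.ι (groupExtendHom Z.Z₂) fun m _ => (E.ι_comm m _).symm

theorem modHom_inl (Z : E.LiftingSystem) (m : Multiplicative M) : Z.modHom (m, 1) = E.ι m := by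
  change E.ι m * groupExtendHom Z.Z₂ 1 = E.ι m
  rw [map_one, mul_one]

theorem modHom_z₂ (Z : E.LiftingSystem) (m : Multiplicative M) (h g : G) :
    Z.modHom (m, z₂ h g) = E.ι m * Z.Z₂ h g := by
  change E.ι m * groupExtendHom Z.Z₂ (z₂ h g) = E.ι m * Z.Z₂ h g
  rw [groupExtendHom_z₂ _ Z.Z₂_one_right Z.Z₂_one_left]

theorem bd_modHom (Z : E.LiftingSystem) (x : Mod G M) : E.bd (Z.modHom x) = Z.freeHom x.2 := by
  have : E.bd.comp Z.modHom =
      Z.freeHom.comp ((K G).subtype.comp (MonoidHom.snd (Multiplicative M) (K G))) := by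
    apply hom_ext_Mod
    · intro m; simp [modHom_inl, E.bd_ι]
    · intro h g; simp [modHom_z₂, Z.bd_Z₂, coe_z₂, freeHom_basis]
  exact DFunLike.congr_fun this x

/-- Equality of cocycles enters here. On `M` both sides agree because the action is the given one;
on the elements `z₂ h g` the claim is the defining relation of the cocycle of `Z`, solved for the
action of `Z.Z₁ k`. -/
theorem modHom_genAut (Z : E.LiftingSystem) {z : Z₃ G M} (hz : Z.cocycle = z.1) (k : G)
    (x : Mod G M) : Z.modHom (genAut z k x) = Z.Z₁ k • Z.modHom x := by
  have : Z.modHom.comp (genAut z k).toMonoidHom =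
      (MulDistribMulAction.toMonoidHom E.modulePart (Z.Z₁ k)).comp Z.modHom := by
    apply hom_ext_Mod
    · intro m
      change Z.modHom (genAut z k _) = Z.Z₁ k • Z.modHom _
      rw [genAut_inl, modHom_inl, modHom_inl, E.smul_ι, Z.π_Z₁]
    · intro h g
      change Z.modHom (genAut z k _) = Z.Z₁ k • Z.modHom _
      have e : ((Multiplicative.ofAdd (-z.1 k h g), z₂ k h * z₂ (k * h) g * (z₂ k (h * g))⁻¹) :
          Mod G M) = (Multiplicative.ofAdd (-z.1 k h g), z₂ k h) * (1, z₂ (k * h) g) *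
            (1, z₂ k (h * g))⁻¹ := by ext1 <;> simp
      rw [genAut_z₂, conj_z₂, e, map_mul, map_mul, map_inv, modHom_z₂, modHom_z₂, modHom_z₂,
        modHom_z₂, map_one, one_mul, one_mul, one_mul, mul_assoc (E.ι _), Z.Z₂_mul, hz, ofAdd_neg,
        map_inv, inv_mul_cancel_left, mul_inv_cancel_right]
  exact DFunLike.congr_fun this x

theorem modHom_actHom (Z : E.LiftingSystem) {z : Z₃ G M} (hz : Z.cocycle = z.1) (w : F G)
    (x : Mod G M) : Z.modHom (actHom z w x) = Z.freeHom w • Z.modHom x := by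
  induction w using FreeGroup.induction_on generalizing x with
  | C1 => simp
  | of y =>
    rw [← basis_of, actHom_basis, freeHom_basis, Z.modHom_genAut hz]
  | inv_of y _ =>
    change Z.modHom (actHom z (FreeGroup.of y)⁻¹ x) = Z.freeHom (FreeGroup.of y)⁻¹ • Z.modHom x
    rw [← basis_of, map_inv, map_inv, actHom_basis, freeHom_basis, eq_inv_smul_iff,
      ← Z.modHom_genAut hz, MulAut.apply_inv_self]
  | mul a b ha hb => rw [map_mul, map_mul, MulAut.mul_apply, ha, hb, mul_smul]

/-- The extension equivalence from the standard extension induced by a lifting system. -/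
noncomputable def toEquivalence (Z : E.LiftingSystem) {z : Z₃ G M} (hz : Z.cocycle = z.1) :
    Equivalence (standardExtension z) E where
  groupHom := Z.freeHom
  moduleHom := Z.modHom
  comm := Z.bd_modHom
  map_smul := Z.modHom_actHom hz
  moduleHom_ι := Z.modHom_inl
  π_groupHom w := by
    have : E.π.comp Z.freeHom = proj G := by
      ext x; simp [freeHom, proj, Z.π_Z₁]
    exact DFunLike.congr_fun this w

end LiftingSystem

/-! ### Invariance under equivalence and the conclusion -/

theorem nonempty_equivalence_standardExtension_iff (E : CrossedModuleExtension G M)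
    (z : Z₃ G M) :
    Nonempty (Equivalence (standardExtension z) E) ↔ ∃ Z : E.LiftingSystem, Z.cocycle = z.1 :=
  ⟨fun ⟨f⟩ => ⟨(LiftingSystem.standard z).map f,
    by rw [LiftingSystem.cocycle_map, LiftingSystem.cocycle_standard]⟩,
    fun ⟨Z, hZ⟩ => ⟨Z.toEquivalence hZ⟩⟩

/-- An extension receives an extension equivalence from the standard extension of every cocycle
that represents its cohomology class. -/
theorem nonempty_equivalence_of_cohomologyClass_eq {E : CrossedModuleExtension G M} {z : Z₃ G M}
    (hz : E.cohomologyClass = QuotientAddGroup.mk z) :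
    Nonempty (Equivalence (standardExtension z) E) := by
  have h := QuotientAddGroup.eq.mp hz
  rw [AddSubgroup.mem_addSubgroupOf] at h
  refine (E.nonempty_equivalence_standardExtension_iff z).mpr
    ((Classical.arbitrary E.LiftingSystem).exists_cocycle_eq ?_)
  rw [sub_eq_neg_add]
  exact h

/-- Extension equivalences from a standard extension lift along extension equivalences. -/
theorem Equivalence.nonempty_iff {X Y : CrossedModuleExtension G M} (f : Equivalence X Y)
    (z : Z₃ G M) : Nonempty (Equivalence (standardExtension z) X) ↔
      Nonempty (Equivalence (standardExtension z) Y) := by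
  refine ⟨fun ⟨e⟩ => ⟨f.comp e⟩, fun h => ?_⟩
  obtain ⟨W, hW⟩ := (Y.nonempty_equivalence_standardExtension_iff z).mp h
  -- Nothing is lifted from `Y` directly: the image of an arbitrary `Z` in `Y` keeps its cocycle and
  -- is compared with `W` there. The resulting coboundary is then absorbed in `X`.
  let Z := Classical.arbitrary X.LiftingSystem
  refine (X.nonempty_equivalence_standardExtension_iff z).mpr (Z.exists_cocycle_eq ?_)
  rw [← hW, ← Z.cocycle_map f]
  exact LiftingSystem.cocycle_sub_cocycle_mem _ _

/-- Since the property transfers in both directions along each extension equivalence, zigzags of any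
length can be followed. -/
theorem Equivalent.nonempty_iff {X Y : CrossedModuleExtension G M} (h : X.Equivalent Y)
    (z : Z₃ G M) : Nonempty (Equivalence (standardExtension z) X) ↔
      Nonempty (Equivalence (standardExtension z) Y) := by
  induction h with
  | rel _ _ h => exact h.some.nonempty_iff z
  | refl => rfl
  | symm _ _ _ ih => exact ih.symm
  | trans _ _ _ _ _ ih ih' => exact ih.trans ih'

end CrossedModuleExtension

theorem mainTheorem6 {G M : Type u} [Group G] [AddCommGroup M] [DistribMulAction G M]
    (E E' : CrossedModuleExtension G M) (z : CptCohomology.Z₃ G M)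
    (hz : E.cohomologyClass = QuotientAddGroup.mk z) :
    (E.Equivalent E' ↔
      Nonempty (CrossedModuleExtension.Equivalence (standardExtension z) E) ∧
      Nonempty (CrossedModuleExtension.Equivalence (standardExtension z) E')) ∧
    (E.Equivalent E' →
      ∃ S : CrossedModuleExtension G M,
        Nonempty (CrossedModuleExtension.Equivalence S E) ∧
        Nonempty (CrossedModuleExtension.Equivalence S E')) := by
  have hE := CrossedModuleExtension.nonempty_equivalence_of_cohomologyClass_eq hz
  refine ⟨⟨fun h => ⟨hE, (h.nonempty_iff z).mp hE⟩, fun ⟨h, h'⟩ => ?_⟩,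
    fun h => ⟨standardExtension z, hE, (h.nonempty_iff z).mp hE⟩⟩
  -- The two extension equivalences form a zigzag from `E` back to the standard extension and on to
  -- `E'`.
  exact .trans _ _ _ (.symm _ _ (.rel _ _ h)) (.rel _ _ h')
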